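/- Let $f_1,\dots,f_N:\mathbb R^d\to\mathbb R$ ($N\ge 1$) be differentiable and $f=\frac1N\sum_{k=1}^N f_k$. Fix $\lambda\in[0,1]$, $c>0$ and $1/2<\alpha\le 1$, and set $\gamma_n=c/n^{\alpha}$ for $n\ge 1$. Let $(X_n)$ be generated by the $\lambda$-SAGA algorithm: $X_0,X_1$ are square integrable random vectors of $\mathbb R^d$; $U_2,U_3,\dots$ are independent random indices, uniformly distributed on $\{1,\dots,N\}$, and the sequence $(U_n)_{n\ge2}$ is independent of $(X_0,X_1)$; $g_{1,k}=\nabla f_k(X_0)$; and, for all $n\ge1$ and $1\le k\le N$, $$X_{n+1}=X_n-\gamma_n\Big(\nabla f_{U_{n+1}}(X_n)-\lambda\Big(g_{n,U_{n+1}}-\frac1N\sum_{j=1}^N g_{n,j}\Big)\Big),\qquad g_{n+1,k}=\begin{cases}\nabla f_k(X_n)&\text{if }U_{n+1}=k,\\ g_{n,k}&\text{otherwise.}\end{cases}$$ Let $p\ge1$ be an integer. Suppose that $X_1\in\mathbf L^{2p}$ and, if $\lambda\ne0$, that also $X_0\in\mathbf L^{2p}$. Suppose further that 1. $f$ is continuously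 differentiable, and $x^*$ is the unique point of $\mathbb R^d$ with $\nabla f(x^*)=0$; 2. there is a constant $\mu>0$ such that $\langle x-x^*,\nabla f(x)\rangle\ge\mu\|x-x^*\|^2$ for all $x\ne x^*$; 3. there is a constant $L_p>0$ such that $\frac1N\sum_{k=1}^N\|\nabla f_k(x)-\nabla f_k(x^*)\|^{2p}\le L_p\|x-x^*\|^{2p}$ for all $x\in\mathbb R^d$; 4. $pc\mu\le2^\alpha$, and $c\mu>1$ if $\alpha=1$. Then there is a constant $K_p>0$ such that, for all $n\ge1$, $X_n-x^*\in\mathbf L^{2p}$ and $$\mathbb E\big[\|X_n-x^*\|^{2p}\big]\le\frac{K_p}{n^{p\alpha}}.$$ -/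

import Mathlib

open MeasureTheory ProbabilityTheory

/-- The objective `f = (1/N) ∑ₖ fₖ` on `ℝ^d`. -/
noncomputable def averageObjective {d N : ℕ} (f : Fin N → EuclideanSpace ℝ (Fin d) → ℝ)
    (x : EuclideanSpace ℝ (Fin d)) : ℝ :=
  (1 / (N : ℝ)) * ∑ k, f k x

/-- `X₀, X₁, X₂, …` is the sequence generated by the `λ`-SAGA algorithm with component functions
`f₁, …, f_N`, parameter `λ = lam`, steps `γ₁, γ₂, …`, sampled indices `U₂, U₃, …` and gradient
table `g n k` (`n ≥ 1`). The values `U 0`, `U 1`, `γ 0` and `g 0` play no role. -/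
structure IsLambdaSAGA {Ω : Type*} [MeasurableSpace Ω] (P : Measure Ω) {d N : ℕ}
    (f : Fin N → EuclideanSpace ℝ (Fin d) → ℝ) (lam : ℝ) (γ : ℕ → ℝ)
    (U : ℕ → Ω → Fin N) (X : ℕ → Ω → EuclideanSpace ℝ (Fin d))
    (g : ℕ → Fin N → Ω → EuclideanSpace ℝ (Fin d)) : Prop where
  /-- the initial states are square integrable random vectors -/
  measurable_init_zero : Measurable (X 0)
  measurable_init_one : Measurable (X 1)
  memLp_init_zero : MemLp (X 0) 2 P
  memLp_init_one : MemLp (X 1) 2 P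
  /-- the indices `U₂, U₃, …` are independent, uniform on the `N` indices, and independent of the
  pair of initial states -/
  measurable_index : ∀ n, Measurable (U (n + 2))
  indep_index : iIndepFun (fun n => U (n + 2)) P
  uniform_index : ∀ n k, P.real {ω | U (n + 2) ω = k} = 1 / (N : ℝ)
  indep_init : IndepFun (fun ω => (X 0 ω, X 1 ω)) (fun ω n => U (n + 2) ω) P
  /-- the gradient table -/
  table_init : ∀ k ω, g 1 k ω = gradient (f k) (X 0 ω)
  table_step : ∀ n, 1 ≤ n → ∀ k ω,
    g (n + 1) k ω = if U (n + 1) ω = k then gradient (f k) (X n ω) else g n k ω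
  /-- the recursion -/
  step : ∀ n, 1 ≤ n → ∀ ω,
    X (n + 1) ω = X n ω - γ n • (gradient (f (U (n + 1) ω)) (X n ω)
      - lam • (g n (U (n + 1) ω) ω - (1 / (N : ℝ)) • ∑ k, g n k ω))

/-! Write `a n` for the moment `E‖X n - xs‖^(2p)` and `b n` for the averaged `2p`-th moment of the
table errors `lam • (g n k - ∇f_k(xs))`. Given the past, the search direction has mean `∇f(X n)`, so
expanding the `2p`-th power of one step gives a linear term that contracts by about `2pμγ`. The
quadratic remainder `γ²‖x‖^(2p-2)‖y‖²` is split by Young's inequality into a small multiple of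
`γ‖x‖^(2p)` and a term `γ^(p+1)‖y‖^(2p)` (`norm_sub_smul_pow_le`). Noise of order `γ^(p+1)` against
contraction of order `γ` gives the equilibrium size `γ^p`, that is `n^(-pα)`.

The direction also involves the table, but only through the factor `γ^(p+1)`. Each table entry is
refreshed with probability `1/N`, so `b (n+1) ≤ (1 - 1/N) b n + (L/N) a n`. This contraction does
not degenerate with `γ`, so the Lyapunov function `a n + M γ_n^(p+1) b n` absorbs the coupling
(`exists_bound_of_coupled_recursion`) and satisfies a scalar recursion solved in
`eventually_le_mul_rpow_of_recursion`. Independence of the fresh index from the past replaces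
conditional expectation (`integral_comp_uniform_of_indep`). -/

/-! ### Pointwise estimates for one step -/

/-- Meant for `s = ‖x‖`, `t = γ‖y‖`, `u = -2γ⟪x, y⟫`. The term linear in `u` is kept exactly, since
it carries the drift after averaging; everything else is of second order in `t`. -/
theorem sq_add_pow_le (p : ℕ) : ∃ C : ℝ, 0 ≤ C ∧ ∀ s t u : ℝ, 0 ≤ s → 0 ≤ t → |u| ≤ 2 * s * t →
    (s ^ 2 + u + t ^ 2) ^ (p + 1) ≤
      s ^ (2 * p + 2) + (p + 1) * s ^ (2 * p) * u + C * (t ^ 2 * (s + t) ^ (2 * p)) := by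
  induction p with
  | zero => exact ⟨1, zero_le_one, fun s t u _ _ _ => by simp⟩
  | succ p ih =>
    obtain ⟨C, hC, h⟩ := ih
    refine ⟨C + 6 * (p + 1) + 1, by positivity, fun s t u hs ht hu => ?_⟩
    have hu' := abs_le.1 hu
    have hnn : 0 ≤ s ^ 2 + u + t ^ 2 := by nlinarith [sq_nonneg (s - t)]
    have hle : s ^ 2 + u + t ^ 2 ≤ (s + t) ^ 2 := by nlinarith
    have hu2 : u ^ 2 ≤ 4 * s ^ 2 * t ^ 2 := by
      have := sq_le_sq' hu'.1 hu'.2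
      nlinarith
    have e : s ^ (2 * p) * s ^ 2 ≤ (s + t) ^ (2 * p + 2) := by
      rw [← pow_add]; gcongr; linarith
    have e' : s ^ (2 * p) * (s * t) ≤ (s + t) ^ (2 * p + 2) := by
      rw [pow_add]; gcongr
      · linarith
      · nlinarith
    have e1 : s ^ (2 * p) * u ^ 2 ≤ 4 * (t ^ 2 * (s + t) ^ (2 * p + 2)) := by
      calc s ^ (2 * p) * u ^ 2 ≤ s ^ (2 * p) * (4 * s ^ 2 * t ^ 2) := by gcongr
        _ = 4 * (t ^ 2 * (s ^ (2 * p) * s ^ 2)) := by ring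
        _ ≤ _ := by gcongr
    have e2 : s ^ (2 * p) * (u * t ^ 2) ≤ 2 * (t ^ 2 * (s + t) ^ (2 * p + 2)) := by
      calc s ^ (2 * p) * (u * t ^ 2) ≤ s ^ (2 * p) * (2 * s * t * t ^ 2) := by
            gcongr; exact hu'.2
        _ = 2 * (t ^ 2 * (s ^ (2 * p) * (s * t))) := by ring
        _ ≤ _ := by gcongr
    have e3 : s ^ (2 * p) * s ^ 2 * t ^ 2 ≤ t ^ 2 * (s + t) ^ (2 * p + 2) := by
      rw [mul_comm (t ^ 2)]; gcongr
    have e4 : t ^ 2 * (s + t) ^ (2 * p) * (s ^ 2 + u + t ^ 2)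
        ≤ t ^ 2 * (s + t) ^ (2 * p + 2) := by
      calc _ ≤ t ^ 2 * (s + t) ^ (2 * p) * (s + t) ^ 2 := by gcongr
        _ = _ := by ring
    calc (s ^ 2 + u + t ^ 2) ^ (p + 1 + 1)
        = (s ^ 2 + u + t ^ 2) ^ (p + 1) * (s ^ 2 + u + t ^ 2) := pow_succ _ _
      _ ≤ (s ^ (2 * p + 2) + (p + 1) * s ^ (2 * p) * u + C * (t ^ 2 * (s + t) ^ (2 * p)))
          * (s ^ 2 + u + t ^ 2) := by gcongr; exact h s t u hs ht hu
      _ = s ^ (2 * (p + 1) + 2) + ((p + 1 : ℕ) + 1) * s ^ (2 * (p + 1)) * u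
          + (s ^ (2 * p) * s ^ 2 * t ^ 2 + (p + 1) * (s ^ (2 * p) * u ^ 2)
            + (p + 1) * (s ^ (2 * p) * (u * t ^ 2))
            + C * (t ^ 2 * (s + t) ^ (2 * p) * (s ^ 2 + u + t ^ 2))) := by
        push_cast; ring
      _ ≤ s ^ (2 * (p + 1) + 2) + ((p + 1 : ℕ) + 1) * s ^ (2 * (p + 1)) * u
          + (t ^ 2 * (s + t) ^ (2 * p + 2) + (p + 1) * (4 * (t ^ 2 * (s + t) ^ (2 * p + 2)))
            + (p + 1) * (2 * (t ^ 2 * (s + t) ^ (2 * p + 2)))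
            + C * (t ^ 2 * (s + t) ^ (2 * p + 2))) := by gcongr
      _ = _ := by ring

theorem pow_mul_le_add_pow {δ : ℝ} (hδ : 0 < δ) (p : ℕ) {v w : ℝ} (hv : 0 ≤ v) (hw : 0 ≤ w) :
    v ^ p * w ≤ δ * v ^ (p + 1) + (δ⁻¹) ^ p * w ^ (p + 1) := by
  rcases le_total w (δ * v) with h | h
  · calc v ^ p * w ≤ v ^ p * (δ * v) := by gcongr
      _ = δ * v ^ (p + 1) := by ring
      _ ≤ _ := le_add_of_nonneg_right (by positivity)
  · have h' : v ≤ δ⁻¹ * w := by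
      rw [inv_mul_eq_div, le_div_iff₀ hδ]; linarith
    calc v ^ p * w ≤ (δ⁻¹ * w) ^ p * w := by gcongr
      _ = (δ⁻¹) ^ p * w ^ (p + 1) := by ring
      _ ≤ _ := le_add_of_nonneg_left (by positivity)

theorem norm_sub_smul_pow_le (p : ℕ) {δ Γ : ℝ} (hδ : 0 < δ) (hΓ : 0 ≤ Γ) :
    ∃ C : ℝ, 0 ≤ C ∧ ∀ {E : Type*} [NormedAddCommGroup E] [InnerProductSpace ℝ E] (x y : E)
      (γ : ℝ), 0 ≤ γ → γ ≤ Γ →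
      ‖x - γ • y‖ ^ (2 * p + 2) ≤ (1 + δ * γ) * ‖x‖ ^ (2 * p + 2)
        - 2 * (p + 1) * γ * ‖x‖ ^ (2 * p) * inner ℝ x y
        + C * γ ^ (p + 2) * ‖y‖ ^ (2 * p + 2) := by
  obtain ⟨C, hC, h⟩ := sq_add_pow_le p
  set D := C * 2 ^ (2 * p) with hD
  -- The Young parameter `ε` is chosen so that `D * ε ≤ δ`.
  have hD0 : 0 ≤ D := by positivity
  set ε := δ / (D + 1) with hε
  have hε0 : 0 < ε := by positivity
  have hDε : D * ε ≤ δ := by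
    rw [hε, mul_div_assoc', div_le_iff₀ (by positivity)]; nlinarith
  refine ⟨D * (ε⁻¹ ^ p + Γ ^ p), by positivity, fun x y γ hγ hγ' => ?_⟩
  have hexp : ‖x - γ • y‖ ^ (2 * p + 2)
      = (‖x‖ ^ 2 + (-(2 * γ * inner ℝ x y)) + (γ * ‖y‖) ^ 2) ^ (p + 1) := by
    rw [show 2 * p + 2 = 2 * (p + 1) by ring, pow_mul, norm_sub_sq_real, inner_smul_right,
      norm_smul, Real.norm_of_nonneg hγ]
    ring
  have hu : |-(2 * γ * inner ℝ x y)| ≤ 2 * ‖x‖ * (γ * ‖y‖) := by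
    rw [abs_neg, abs_mul, abs_of_nonneg (by positivity)]
    have := abs_real_inner_le_norm x y
    calc 2 * γ * |inner ℝ x y| ≤ 2 * γ * (‖x‖ * ‖y‖) := by gcongr
      _ = _ := by ring
  have hsum : (‖x‖ + γ * ‖y‖) ^ (2 * p)
      ≤ 2 ^ (2 * p) * (‖x‖ ^ (2 * p) + (γ * ‖y‖) ^ (2 * p)) := by
    refine (add_pow_le (by positivity) (by positivity) _).trans ?_
    gcongr
    · norm_num
    · omega
  have hyoung := pow_mul_le_add_pow hε0 p (sq_nonneg ‖x‖)
    (w := γ * ‖y‖ ^ 2) (by positivity)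
  -- One factor `γ` is held outside Young's inequality, which yields exactly `γ ^ (p + 2)`; the
  -- higher power `γ ^ (2 * p + 2)` is reduced to it by `γ ≤ Γ`.
  have hmain : (γ * ‖y‖) ^ 2 * (‖x‖ ^ (2 * p) + (γ * ‖y‖) ^ (2 * p))
      ≤ ε * γ * ‖x‖ ^ (2 * p + 2)
        + (ε⁻¹ ^ p + Γ ^ p) * (γ ^ (p + 2) * ‖y‖ ^ (2 * p + 2)) := by
    calc _ = γ * ((‖x‖ ^ 2) ^ p * (γ * ‖y‖ ^ 2))
          + γ ^ p * (γ ^ (p + 2) * ‖y‖ ^ (2 * p + 2)) := by ring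
      _ ≤ γ * (ε * (‖x‖ ^ 2) ^ (p + 1) + ε⁻¹ ^ p * (γ * ‖y‖ ^ 2) ^ (p + 1))
          + Γ ^ p * (γ ^ (p + 2) * ‖y‖ ^ (2 * p + 2)) := by gcongr
      _ = _ := by ring
  rw [hexp]
  calc _ ≤ _ := h ‖x‖ (γ * ‖y‖) _ (norm_nonneg _) (by positivity) hu
    _ ≤ ‖x‖ ^ (2 * p + 2) + (p + 1) * ‖x‖ ^ (2 * p) * (-(2 * γ * inner ℝ x y))
        + C * ((γ * ‖y‖) ^ 2 * (2 ^ (2 * p) * (‖x‖ ^ (2 * p) + (γ * ‖y‖) ^ (2 * p)))) := by gcongr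
    _ = ‖x‖ ^ (2 * p + 2) + (p + 1) * ‖x‖ ^ (2 * p) * (-(2 * γ * inner ℝ x y))
        + D * ((γ * ‖y‖) ^ 2 * (‖x‖ ^ (2 * p) + (γ * ‖y‖) ^ (2 * p))) := by rw [hD]; ring
    _ ≤ ‖x‖ ^ (2 * p + 2) + (p + 1) * ‖x‖ ^ (2 * p) * (-(2 * γ * inner ℝ x y))
        + D * (ε * γ * ‖x‖ ^ (2 * p + 2)
        + (ε⁻¹ ^ p + Γ ^ p) * (γ ^ (p + 2) * ‖y‖ ^ (2 * p + 2))) := by gcongr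
    _ = (1 + D * ε * γ) * ‖x‖ ^ (2 * p + 2)
        - 2 * (p + 1) * γ * ‖x‖ ^ (2 * p) * inner ℝ x y
        + D * (ε⁻¹ ^ p + Γ ^ p) * γ ^ (p + 2) * ‖y‖ ^ (2 * p + 2) := by ring
    _ ≤ _ := by gcongr

theorem norm_average_pow_le {E : Type*} [NormedAddCommGroup E] [NormedSpace ℝ E] {N : ℕ}
    (hN : 1 ≤ N) (h : Fin N → E) (q : ℕ) :
    ‖(1 / (N : ℝ)) • ∑ k, h k‖ ^ q ≤ (1 / (N : ℝ)) * ∑ k, ‖h k‖ ^ q := by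
  have hN' : (0 : ℝ) < N := by exact_mod_cast hN
  have := Real.pow_arith_mean_le_arith_mean_pow Finset.univ (fun _ : Fin N => 1 / (N : ℝ))
    (fun k => ‖h k‖) (fun _ _ => by positivity) (by simp [hN'.ne']) (fun _ _ => norm_nonneg _) q
  rw [← Finset.mul_sum, ← Finset.mul_sum] at this
  refine le_trans ?_ this
  gcongr
  rw [norm_smul, Real.norm_of_nonneg (by positivity)]
  gcongr
  exact norm_sum_le _ _

theorem norm_four_terms_pow_le {E : Type*} [NormedAddCommGroup E] (a b c e : E) (q : ℕ) :
    ‖a - b + c + e‖ ^ q ≤ 4 ^ q * (‖a‖ ^ q + ‖b‖ ^ q + ‖c‖ ^ q + ‖e‖ ^ q) := by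
  have two (a b : ℝ) (ha : 0 ≤ a) (hb : 0 ≤ b) : (a + b) ^ q ≤ 2 ^ q * (a ^ q + b ^ q) := by
    refine (add_pow_le ha hb q).trans ?_
    gcongr
    · norm_num
    · omega
  have h : ‖a - b + c + e‖ ≤ (‖a‖ + ‖b‖) + (‖c‖ + ‖e‖) := by
    have h1 := norm_add_le (a - b + c) e
    have h2 := norm_add_le (a - b) c
    have h3 := norm_sub_le a b
    linarith
  calc _ ≤ ((‖a‖ + ‖b‖) + (‖c‖ + ‖e‖)) ^ q := by gcongr
    _ ≤ 2 ^ q * ((‖a‖ + ‖b‖) ^ q + (‖c‖ + ‖e‖) ^ q) := two _ _ (by positivity) (by positivity)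
    _ ≤ 2 ^ q * (2 ^ q * (‖a‖ ^ q + ‖b‖ ^ q) + 2 ^ q * (‖c‖ ^ q + ‖e‖ ^ q)) := by
      gcongr <;> exact two _ _ (norm_nonneg _) (norm_nonneg _)
    _ = _ := by
      rw [show (4 : ℝ) = 2 * 2 by norm_num, mul_pow]; ring

/-- The SAGA correction is centred, so the averaged inner product sees only the mean gradient. Since
the `S k` average to zero, the direction splits into gradient error, table error, mean table error
and `(1 - lam) • S k`, each with controlled moment. The factor `lam` stays inside the table error.
-/
theorem average_norm_step_pow_le (p : ℕ) {δ Γ L : ℝ} (μ B : ℝ) (hδ : 0 < δ) (hΓ : 0 ≤ Γ)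
    (hL : 0 ≤ L) (hB : 0 ≤ B) :
    ∃ C : ℝ, 0 ≤ C ∧ ∀ {E : Type*} [NormedAddCommGroup E] [InnerProductSpace ℝ E] {N : ℕ}
      (x : E) (G S g : Fin N → E) (lam γ : ℝ), 1 ≤ N → 0 ≤ γ → γ ≤ Γ → lam ∈ Set.Icc (0 : ℝ) 1 →
      (1 / (N : ℝ)) • ∑ k, S k = 0 →
      μ * ‖x‖ ^ 2 ≤ inner ℝ x ((1 / (N : ℝ)) • ∑ k, G k) →
      (1 / (N : ℝ)) * ∑ k, ‖G k - S k‖ ^ (2 * p + 2) ≤ L * ‖x‖ ^ (2 * p + 2) →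
      (1 / (N : ℝ)) * ∑ k, ‖S k‖ ^ (2 * p + 2) ≤ B →
      (1 / (N : ℝ)) * ∑ k, ‖x - γ • (G k - lam • (g k - (1 / (N : ℝ)) • ∑ j, g j))‖ ^ (2 * p + 2)
        ≤ (1 - (2 * (p + 1) * μ - δ) * γ + C * γ ^ (p + 2)) * ‖x‖ ^ (2 * p + 2)
          + C * γ ^ (p + 2)
            * ((1 / (N : ℝ)) * ∑ k, ‖lam • (g k - S k)‖ ^ (2 * p + 2) + 1) := by
  obtain ⟨C, hC, hstep⟩ := norm_sub_smul_pow_le p hδ hΓ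
  refine ⟨C * 4 ^ (2 * p + 2) * (L + 2 + B), by positivity,
    fun {E} _ _ {N} x G S g lam γ hN hγ hγ' hlam hS hsec hLip hSB => ?_⟩
  have hN' : (0 : ℝ) < N := by exact_mod_cast hN
  set A : ℝ := (1 / (N : ℝ)) * ∑ k, ‖lam • (g k - S k)‖ ^ (2 * p + 2) with hA
  have hA0 : 0 ≤ A := by positivity
  set Y : Fin N → E := fun k => G k - lam • (g k - (1 / (N : ℝ)) • ∑ j, g j) with hY
  have havg (a : ℝ) : (1 / (N : ℝ)) * ∑ _k : Fin N, a = a := by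
    simp [hN'.ne']
  have havg' (v : E) : (1 / (N : ℝ)) • ∑ _k : Fin N, v = v := by
    rw [Finset.sum_const, Finset.card_univ, Fintype.card_fin, ← Nat.cast_smul_eq_nsmul ℝ,
      smul_smul, one_div, inv_mul_cancel₀ hN'.ne', one_smul]
  have hYmean : (1 / (N : ℝ)) • ∑ k, Y k = (1 / (N : ℝ)) • ∑ k, G k := by
    simp only [hY, Finset.sum_sub_distrib, ← Finset.smul_sum, smul_sub]
    rw [smul_comm (1 / (N : ℝ)) lam, smul_comm (1 / (N : ℝ)) lam, havg', sub_self, sub_zero]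
  have hmean : (1 / (N : ℝ)) • ∑ k, lam • (g k - S k) = lam • (1 / (N : ℝ)) • ∑ k, g k := by
    rw [← Finset.smul_sum, smul_comm, Finset.sum_sub_distrib, smul_sub, hS, sub_zero]
  have hYdec (k) : Y k = (G k - S k) - lam • (g k - S k)
      + (1 / (N : ℝ)) • ∑ j, lam • (g j - S j) + (1 - lam) • S k := by
    rw [hmean]; simp only [hY]; module
  have hYk (k) : ‖Y k‖ ^ (2 * p + 2) ≤ 4 ^ (2 * p + 2) * (‖G k - S k‖ ^ (2 * p + 2)
      + ‖lam • (g k - S k)‖ ^ (2 * p + 2) + A + ‖S k‖ ^ (2 * p + 2)) := by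
    rw [hYdec]
    refine (norm_four_terms_pow_le _ _ _ _ _).trans ?_
    gcongr
    · exact norm_average_pow_le hN _ _
    · rw [norm_smul, Real.norm_of_nonneg (by linarith [hlam.2])]
      exact mul_le_of_le_one_left (norm_nonneg _) (by linarith [hlam.1])
  have hYavg : (1 / (N : ℝ)) * ∑ k, ‖Y k‖ ^ (2 * p + 2)
      ≤ 4 ^ (2 * p + 2) * (L + 2 + B) * (‖x‖ ^ (2 * p + 2) + A + 1) := by
    calc _ ≤ (1 / (N : ℝ)) * ∑ k, 4 ^ (2 * p + 2) * (‖G k - S k‖ ^ (2 * p + 2)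
          + ‖lam • (g k - S k)‖ ^ (2 * p + 2) + A + ‖S k‖ ^ (2 * p + 2)) := by
          gcongr with k; exact hYk k
      _ = 4 ^ (2 * p + 2) * ((1 / (N : ℝ)) * ∑ k, ‖G k - S k‖ ^ (2 * p + 2) + A
          + (1 / (N : ℝ)) * ∑ _k : Fin N, A + (1 / (N : ℝ)) * ∑ k, ‖S k‖ ^ (2 * p + 2)) := by
        rw [← Finset.mul_sum, Finset.sum_add_distrib, Finset.sum_add_distrib,
          Finset.sum_add_distrib, hA]
        ring
      _ ≤ 4 ^ (2 * p + 2) * (L * ‖x‖ ^ (2 * p + 2) + A + A + B) := by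
        rw [havg]; gcongr
      _ ≤ 4 ^ (2 * p + 2) * ((L + 2 + B) * (‖x‖ ^ (2 * p + 2) + A + 1)) := by
        have hx : 0 ≤ ‖x‖ ^ (2 * p + 2) := by positivity
        gcongr
        nlinarith [mul_nonneg hB hx, mul_nonneg hB hA0, mul_nonneg hL hA0]
      _ = _ := by ring
  have hinner : (1 / (N : ℝ)) * ∑ k, inner ℝ x (Y k)
      = inner ℝ x ((1 / (N : ℝ)) • ∑ k, G k) := by
    rw [← hYmean, inner_smul_right, inner_sum]
  calc (1 / (N : ℝ)) * ∑ k, ‖x - γ • Y k‖ ^ (2 * p + 2)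
      ≤ (1 / (N : ℝ)) * ∑ k, ((1 + δ * γ) * ‖x‖ ^ (2 * p + 2)
        - 2 * (p + 1) * γ * ‖x‖ ^ (2 * p) * inner ℝ x (Y k)
        + C * γ ^ (p + 2) * ‖Y k‖ ^ (2 * p + 2)) := by
        gcongr with k; exact hstep x (Y k) γ hγ hγ'
    _ = (1 / (N : ℝ)) * ∑ _k : Fin N, ((1 + δ * γ) * ‖x‖ ^ (2 * p + 2))
        - 2 * (p + 1) * γ * ‖x‖ ^ (2 * p) * ((1 / (N : ℝ)) * ∑ k, inner ℝ x (Y k))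
        + C * γ ^ (p + 2) * ((1 / (N : ℝ)) * ∑ k, ‖Y k‖ ^ (2 * p + 2)) := by
      rw [Finset.sum_add_distrib, Finset.sum_sub_distrib, ← Finset.mul_sum, ← Finset.mul_sum,
        ← Finset.mul_sum]
      ring
    _ ≤ (1 + δ * γ) * ‖x‖ ^ (2 * p + 2)
        - 2 * (p + 1) * γ * ‖x‖ ^ (2 * p) * (μ * ‖x‖ ^ 2)
        + C * γ ^ (p + 2)
          * (4 ^ (2 * p + 2) * (L + 2 + B) * (‖x‖ ^ (2 * p + 2) + A + 1)) := by
      rw [havg, hinner]; gcongr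
    _ = _ := by ring

/-! ### Deterministic recursions -/

-- `K n^(-qα)` is a supersolution: its relative decrease per step is at most `qα/n`, which the
-- contraction `ρ n^(-α)` beats with a margin `η n^(-α)` left for the forcing. For `α < 1` this is
-- automatic for large `n`; for `α = 1` it needs `q < ρ`.
open Filter Topology in
theorem eventually_le_mul_rpow_of_recursion {T : ℕ → ℝ} {ρ D α q : ℝ} (hα : 0 < α) (hα' : α ≤ 1)
    (hρ : 0 < ρ) (hD : 0 ≤ D) (hq : 0 < q) (hρq : α = 1 → q < ρ)
    (hT : ∀ᶠ n : ℕ in atTop, T (n + 1) ≤ (1 - ρ * (n : ℝ) ^ (-α)) * T n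
      + D * ((n : ℝ) ^ (-α) * (n : ℝ) ^ (-(q * α)))) :
    ∃ K : ℝ, 0 < K ∧ ∀ᶠ n : ℕ in atTop, T n ≤ K * (n : ℝ) ^ (-(q * α)) := by
  obtain ⟨η, hη, hev⟩ : ∃ η : ℝ, 0 < η ∧
      ∀ᶠ n : ℕ in atTop, q * α / (n : ℝ) ≤ (ρ - η) * (n : ℝ) ^ (-α) := by
    rcases hα'.eq_or_lt with rfl | h1
    · refine ⟨ρ - q, sub_pos.2 (hρq rfl), Eventually.of_forall fun n => ?_⟩
      rw [Real.rpow_neg_one]; apply le_of_eq; ring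
    · refine ⟨ρ / 2, by positivity, ?_⟩
      have hlim : Tendsto (fun n : ℕ => (n : ℝ) ^ (1 - α)) atTop atTop :=
        (tendsto_rpow_atTop (sub_pos.2 h1)).comp tendsto_natCast_atTop_atTop
      filter_upwards [hlim.eventually_ge_atTop (q * α / (ρ / 2)), eventually_gt_atTop 0]
        with n hn hn0
      have hn0' : (0 : ℝ) < n := by exact_mod_cast hn0
      rw [div_le_iff₀ (by positivity)] at hn
      rw [div_le_iff₀ hn0']
      calc q * α ≤ (n : ℝ) ^ (1 - α) * (ρ / 2) := hn
        _ = (ρ - ρ / 2) * ((n : ℝ) ^ (-α) * (n : ℝ) ^ (1 : ℝ)) := by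
          rw [← Real.rpow_add hn0']; ring_nf
        _ = _ := by rw [Real.rpow_one]; ring
  have hsmall : ∀ᶠ n : ℕ in atTop, ρ * (n : ℝ) ^ (-α) ≤ 1 := by
    have hlim : Tendsto (fun n : ℕ => ρ * (n : ℝ) ^ (-α)) atTop (𝓝 (ρ * 0)) :=
      ((tendsto_rpow_neg_atTop hα).comp tendsto_natCast_atTop_atTop).const_mul ρ
    rw [mul_zero] at hlim
    exact hlim.eventually_le_const one_pos
  obtain ⟨n₀, hn₀⟩ := eventually_atTop.1
    (hT.and (hev.and (hsmall.and (eventually_gt_atTop 0))))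
  have hn₀0 : (0 : ℝ) < n₀ := by exact_mod_cast (hn₀ n₀ le_rfl).2.2.2
  -- The first summand starts the induction at `n₀`; the second gives `D ≤ K * η`.
  set K := |T n₀| * (n₀ : ℝ) ^ (q * α) + D / η + 1 with hK
  have hK0 : 0 < K := by positivity
  have hKD : D ≤ K * η := by
    rw [← div_le_iff₀ hη, hK]
    have : 0 ≤ |T n₀| * (n₀ : ℝ) ^ (q * α) := by positivity
    linarith
  refine ⟨K, hK0, eventually_atTop.2 ⟨n₀, fun n hn => ?_⟩⟩
  induction n, hn using Nat.le_induction with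
  | base =>
    rw [Real.rpow_neg hn₀0.le, ← div_eq_mul_inv, le_div_iff₀ (by positivity)]
    calc T n₀ * (n₀ : ℝ) ^ (q * α) ≤ |T n₀| * (n₀ : ℝ) ^ (q * α) := by
          gcongr; exact le_abs_self _
      _ ≤ K := by rw [hK]; have : 0 ≤ D / η := by positivity
                  linarith
  | succ n hn ih =>
    obtain ⟨h1, h2, h3, h4⟩ := hn₀ n hn
    have hn0 : (0 : ℝ) < n := by exact_mod_cast h4
    set v := (n : ℝ) ^ (-(q * α)) with hv
    have hv0 : 0 < v := by positivity
    set w := (n : ℝ) ^ (-α) with hw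
    have hw0 : 0 < w := by positivity
    have hratio : v * (1 - q * α / n) ≤ ((n + 1 : ℕ) : ℝ) ^ (-(q * α)) := by
      have hb : ((n + 1 : ℕ) : ℝ) = n * (1 + 1 / n) := by push_cast; field_simp
      rw [hb, Real.mul_rpow hn0.le (by positivity), ← hv]
      gcongr
      -- Bernoulli's inequality for a negative exponent, from `log x ≤ x - 1` and `1 + y ≤ exp y`.
      have hpos : (0 : ℝ) < 1 + 1 / n := by positivity
      rw [Real.rpow_def_of_pos hpos]
      have hlog := Real.log_le_sub_one_of_pos hpos
      have hexp := Real.add_one_le_exp (Real.log (1 + 1 / (n : ℝ)) * -(q * α))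
      refine le_trans ?_ hexp
      have hqα : 0 < q * α := by positivity
      have : Real.log (1 + 1 / (n : ℝ)) * (q * α) ≤ 1 / n * (q * α) := by
        gcongr; linarith
      have e : 1 / (n : ℝ) * (q * α) = q * α / n := by ring
      linarith
    calc T (n + 1) ≤ (1 - ρ * w) * T n + D * (w * v) := h1
      _ ≤ (1 - ρ * w) * (K * v) + K * η * (w * v) := by
        have : 0 ≤ 1 - ρ * w := by linarith
        gcongr
      _ = K * (v * (1 - (ρ - η) * w)) := by ring
      _ ≤ K * (v * (1 - q * α / n)) := by gcongr
      _ ≤ _ := by gcongr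

open Filter Topology in
theorem exists_bound_of_coupled_recursion (p : ℕ) {a b : ℕ → ℝ} {ρ σ C α c θ L : ℝ}
    (hc : 0 < c) (hα : 0 < α) (hα' : α ≤ 1) (hρ : 0 < ρ) (hσ : ρ < σ) (hC : 0 ≤ C) (hθ : 0 < θ)
    (hρc : α = 1 → p + 1 < ρ * c) (ha0 : ∀ n, 1 ≤ n → 0 ≤ a n) (hb0 : ∀ n, 1 ≤ n → 0 ≤ b n)
    (ha : ∀ n : ℕ, 1 ≤ n → a (n + 1) ≤
      (1 - σ * (c / (n : ℝ) ^ α) + C * (c / (n : ℝ) ^ α) ^ (p + 2)) * a n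
        + C * (c / (n : ℝ) ^ α) ^ (p + 2) * (b n + 1))
    (hb : ∀ n : ℕ, 1 ≤ n → b (n + 1) ≤ (1 - θ) * b n + L * a n) :
    ∃ K : ℝ, 0 < K ∧ ∀ n : ℕ, 1 ≤ n → a n ≤ K / (n : ℝ) ^ (((p + 1 : ℕ) : ℝ) * α) := by
  set γ : ℕ → ℝ := fun n => c / (n : ℝ) ^ α with hγ
  -- With `M * θ = 2 * C`, half of the table contraction pays for the coupling `C`; the other half,
  -- once `ρ γ ≤ θ / 2`, makes the table part contract at rate `ρ γ`.
  set M := 2 * C / θ with hM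
  have hM0 : 0 ≤ M := by positivity
  have hMθ : M * θ = 2 * C := by rw [hM]; field_simp
  set T : ℕ → ℝ := fun n => a n + M * γ n ^ (p + 2) * b n with hTdef
  have hγ0 (n : ℕ) : 0 ≤ γ n := by positivity
  have hγlim : Tendsto γ atTop (𝓝 0) := by
    have h : Tendsto (fun n : ℕ => (n : ℝ) ^ α) atTop atTop :=
      (tendsto_rpow_atTop hα).comp tendsto_natCast_atTop_atTop
    exact h.const_div_atTop c
  have hγpow : Tendsto (fun n => (C + M * L) * γ n ^ (p + 1)) atTop (𝓝 0) := by
    simpa using (hγlim.pow (p + 1)).const_mul (C + M * L)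
  have hγρ : Tendsto (fun n => ρ * γ n) atTop (𝓝 0) := by simpa using hγlim.const_mul ρ
  have hγeq (n : ℕ) : γ n = c * (n : ℝ) ^ (-α) := by
    rw [hγ, Real.rpow_neg (Nat.cast_nonneg n)]; rfl
  have hrec : ∀ᶠ n : ℕ in atTop, T (n + 1) ≤ (1 - (ρ * c) * (n : ℝ) ^ (-α)) * T n
      + (C * c ^ (p + 2)) * ((n : ℝ) ^ (-α) * (n : ℝ) ^ (-(((p + 1 : ℕ) : ℝ) * α))) := by
    filter_upwards [hγpow.eventually_le_const (sub_pos.2 hσ), hγρ.eventually_le_const (half_pos hθ),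
      eventually_ge_atTop 1] with n h1 h2 hn
    have hn0 : (0 : ℝ) < n := by exact_mod_cast hn
    have han := ha0 n hn
    have hbn := hb0 n hn
    have hbn' := hb0 (n + 1) (by omega)
    have hmono : γ (n + 1) ≤ γ n := by
      simp only [hγ]; gcongr; omega
    have hpow : (n : ℝ) ^ (-α) * (n : ℝ) ^ (-(((p + 1 : ℕ) : ℝ) * α))
        = ((n : ℝ) ^ (-α)) ^ (p + 2) := by
      rw [← Real.rpow_add hn0, ← Real.rpow_natCast, ← Real.rpow_mul hn0.le]
      congr 1; push_cast; ring
    rw [hpow, mul_assoc C, ← mul_pow, mul_assoc ρ, ← hγeq]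
    have hG : 0 ≤ γ n ^ (p + 2) := by have := hγ0 n; positivity
    -- The gap `σ - ρ` absorbs the terms of order `γ ^ (p + 2)` multiplying `a n`.
    have e1 : (C + M * L) * γ n ^ (p + 2) ≤ (σ - ρ) * γ n := by
      calc _ = (C + M * L) * γ n ^ (p + 1) * γ n := by ring
        _ ≤ _ := by gcongr
    have e2 : C + M - M * θ ≤ M - M * (ρ * γ n) := by
      nlinarith [mul_le_mul_of_nonneg_left h2 hM0]
    calc T (n + 1) ≤ ((1 - σ * γ n + C * γ n ^ (p + 2)) * a n
          + C * γ n ^ (p + 2) * (b n + 1)) + M * γ n ^ (p + 2) * ((1 - θ) * b n + L * a n) := by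
          refine add_le_add (ha n hn) ?_
          calc M * γ (n + 1) ^ (p + 2) * b (n + 1) ≤ M * γ n ^ (p + 2) * b (n + 1) := by
                have := hγ0 (n + 1)
                gcongr
            _ ≤ _ := by gcongr; exact hb n hn
      _ = (1 - σ * γ n + (C + M * L) * γ n ^ (p + 2)) * a n
          + γ n ^ (p + 2) * b n * (C + M - M * θ) + C * γ n ^ (p + 2) := by ring
      _ ≤ (1 - σ * γ n + (σ - ρ) * γ n) * a n
          + γ n ^ (p + 2) * b n * (M - M * (ρ * γ n)) + C * γ n ^ (p + 2) := by
        refine add_le_add (add_le_add ?_ ?_) le_rfl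
        · gcongr
        · exact mul_le_mul_of_nonneg_left e2 (mul_nonneg hG hbn)
      _ = _ := by simp only [hTdef]; ring
  obtain ⟨K, hK, hev⟩ := eventually_le_mul_rpow_of_recursion hα hα' (mul_pos hρ hc)
    (by positivity) (by positivity : (0 : ℝ) < ((p + 1 : ℕ) : ℝ))
    (fun h => by push_cast; exact hρc h) hrec
  obtain ⟨n₀, hn₀⟩ := eventually_atTop.1 hev
  set R : ℕ → ℝ := fun n => a n * (n : ℝ) ^ (((p + 1 : ℕ) : ℝ) * α) with hR
  -- The sum covers the finitely many indices before `n₀`.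
  refine ⟨K + ∑ i ∈ Finset.range n₀, |R i|, by positivity, fun n hn => ?_⟩
  have hn0 : (0 : ℝ) < n := by exact_mod_cast hn
  rw [le_div_iff₀ (by positivity)]
  rcases lt_or_ge n n₀ with h | h
  · have := Finset.single_le_sum (f := fun i => |R i|) (fun i _ => abs_nonneg _)
      (Finset.mem_range.2 h)
    have := le_abs_self (R n)
    simp only [hR] at *
    linarith
  · have h1 := hn₀ n h
    have h2 : a n ≤ T n := by
      have := hb0 n hn
      have := hγ0 n
      exact le_add_of_nonneg_right (by positivity)
    have h3 := h2.trans h1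
    rw [Real.rpow_neg hn0.le, ← div_eq_mul_inv, le_div_iff₀ (by positivity)] at h3
    have : 0 ≤ ∑ i ∈ Finset.range n₀, |R i| := by positivity
    linarith

/-! ### Gradients, independence and the sampling history -/

theorem gradient_averageObjective {d N : ℕ} {f : Fin N → EuclideanSpace ℝ (Fin d) → ℝ}
    (hf : ∀ k, Differentiable ℝ (f k)) (x : EuclideanSpace ℝ (Fin d)) :
    gradient (averageObjective f) x = (1 / (N : ℝ)) • ∑ k, gradient (f k) x := by
  refine HasGradientAt.gradient ?_
  rw [hasGradientAt_iff_hasFDerivAt, map_smul, map_sum]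
  refine HasFDerivAt.const_mul ?_ (1 / (N : ℝ))
  exact HasFDerivAt.fun_sum fun k _ => ((hf k x).hasGradientAt).hasFDerivAt

theorem measurable_gradient {E : Type*} [NormedAddCommGroup E] [InnerProductSpace ℝ E]
    [CompleteSpace E] [MeasurableSpace E] [BorelSpace E] (f : E → ℝ) :
    Measurable (gradient f) :=
  (InnerProductSpace.toDual ℝ E).symm.continuous.measurable.comp (measurable_fderiv ℝ f)

/-- The joint law of the three variables is a triple product, which may be reassociated. -/
theorem ProbabilityTheory.IndepFun.prodMk_left_of_indepFun_prodMk {Ω α β δ : Type*}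
    [MeasurableSpace Ω] [MeasurableSpace α] [MeasurableSpace β] [MeasurableSpace δ]
    {P : Measure Ω} [IsProbabilityMeasure P] {W : Ω → α} {A : Ω → β} {B : Ω → δ}
    (hW : Measurable W) (hA : Measurable A) (hB : Measurable B)
    (h : IndepFun W (fun ω => (A ω, B ω)) P) (hAB : IndepFun A B P) :
    IndepFun (fun ω => (W ω, A ω)) B P := by
  have hWA : IndepFun W A P := h.comp measurable_id measurable_fst
  have := Measure.isProbabilityMeasure_map (μ := P) hW.aemeasurable
  have := Measure.isProbabilityMeasure_map (μ := P) hA.aemeasurable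
  have := Measure.isProbabilityMeasure_map (μ := P) hB.aemeasurable
  rw [indepFun_iff_map_prod_eq_prod_map_map hW.aemeasurable (hA.prodMk hB).aemeasurable] at h
  rw [indepFun_iff_map_prod_eq_prod_map_map hA.aemeasurable hB.aemeasurable] at hAB
  rw [indepFun_iff_map_prod_eq_prod_map_map hW.aemeasurable hA.aemeasurable] at hWA
  rw [indepFun_iff_map_prod_eq_prod_map_map (hW.prodMk hA).aemeasurable hB.aemeasurable]
  refine MeasurableEquiv.prodAssoc.map_measurableEquiv_injective ?_
  rw [hWA, Measure.prodAssoc_prod, ← hAB, ← h,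
    Measure.map_map MeasurableEquiv.prodAssoc.measurable ((hW.prodMk hA).prodMk hB)]
  rfl

theorem measurable_apply_index {Ω E ι : Type*} {m : MeasurableSpace Ω} [MeasurableSpace E]
    [MeasurableSpace ι] [Countable ι] [MeasurableSingletonClass ι] {F : ι → Ω → E} {V : Ω → ι}
    (hF : ∀ k, Measurable (F k)) (hV : Measurable V) : Measurable fun ω => F (V ω) ω := by
  have : Measurable (fun z : Ω × ι => F z.2 z.1) := measurable_from_prod_countable_left hF
  exact this.comp (measurable_id.prodMk hV)

/-- Decompose over the values of `V`: each indicator is independent of `Φ k` and has mean `1 / N`.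
-/
theorem integral_comp_uniform_of_indep {Ω : Type*} {m mΩ : MeasurableSpace Ω} {P : Measure Ω}
    [IsProbabilityMeasure P] {N : ℕ} {V : Ω → Fin N} (hV : Measurable V)
    (hunif : ∀ k, P.real {ω | V ω = k} = 1 / (N : ℝ))
    (hind : Indep m (MeasurableSpace.comap V inferInstance) P) {Φ : Fin N → Ω → ℝ}
    (hΦm : ∀ k, Measurable[m] (Φ k)) (hΦ : ∀ k, Integrable (Φ k) P) :
    Integrable (fun ω => Φ (V ω) ω) P ∧
      ∫ ω, Φ (V ω) ω ∂P = ∫ ω, (1 / (N : ℝ)) * ∑ k, Φ k ω ∂P := by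
  have hms (k : Fin N) : MeasurableSet {ω | V ω = k} := hV (measurableSet_singleton k)
  have heq : (fun ω => Φ (V ω) ω)
      = fun ω => ∑ k, Set.indicator {ω | V ω = k} (fun _ => (1 : ℝ)) ω * Φ k ω := by
    funext ω
    rw [Finset.sum_eq_single (V ω)]
    · simp
    · intro k _ hk
      rw [Set.indicator_of_notMem (by simpa using hk.symm), zero_mul]
    · simp
  have hint (k : Fin N) :
      Integrable (fun ω => Set.indicator {ω | V ω = k} (fun _ => (1 : ℝ)) ω * Φ k ω) P := by
    refine ((hΦ k).indicator (hms k)).congr (Filter.Eventually.of_forall fun ω => ?_)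
    by_cases hω : V ω = k <;> simp [Set.indicator, hω]
  refine ⟨heq ▸ integrable_finsetSum _ fun k _ => hint k, ?_⟩
  rw [heq, integral_finsetSum _ fun k _ => hint k, integral_const_mul,
    integral_finsetSum _ fun k _ => hΦ k, Finset.mul_sum]
  refine Finset.sum_congr rfl fun k _ => ?_
  have hindk : IndepFun (Φ k) (Set.indicator {ω | V ω = k} (fun _ => (1 : ℝ))) P := by
    have h1 : IndepFun (Φ k) V P :=
      indep_of_indep_of_le_left hind (hΦm k).comap_le
    exact h1.comp measurable_id (ψ := Set.indicator {k} fun _ => (1 : ℝ))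
      (measurable_of_finite _)
  rw [hindk.symm.integral_fun_mul_eq_mul_integral
    ((measurable_const.indicator (hms k)).aestronglyMeasurable) (hΦ k).aestronglyMeasurable,
    integral_indicator_const _ (hms k), hunif, smul_eq_mul, mul_one]

/-- The information carried by the initial states and the first `n` sampled indices. -/
@[reducible] def sagaHistory {Ω E : Type*} [MeasurableSpace E] {N : ℕ} (U : ℕ → Ω → Fin N) (X : ℕ → Ω → E)
    (n : ℕ) : MeasurableSpace Ω :=
  MeasurableSpace.comap
    (fun ω => ((X 0 ω, X 1 ω), fun i : Finset.range n => U (i + 2) ω)) inferInstance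

section History

variable {Ω E : Type*} [MeasurableSpace E] {N : ℕ} (U : ℕ → Ω → Fin N) (X : ℕ → Ω → E)

theorem sagaHistory_mono_succ (n : ℕ) : sagaHistory U X n ≤ sagaHistory U X (n + 1) := by
  have hr : Measurable (fun z : (E × E) × (Finset.range (n + 1) → Fin N) =>
      (z.1, fun i : Finset.range n => z.2 ⟨i, by have := Finset.mem_range.1 i.2; simp; omega⟩)) := by
    fun_prop
  refine Measurable.comap_le (m₂ := inferInstance) ?_
  exact hr.comp (comap_measurable _)

theorem measurable_index_sagaHistory (n : ℕ) :
    Measurable[sagaHistory U X (n + 1)] (U (n + 2)) := by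
  have hr : Measurable (fun z : (E × E) × (Finset.range (n + 1) → Fin N) =>
      z.2 ⟨n, by simp⟩) := by fun_prop
  exact hr.comp (comap_measurable _)

theorem measurable_init_sagaHistory :
    Measurable[sagaHistory U X 0] (X 0) ∧ Measurable[sagaHistory U X 0] (X 1) :=
  ⟨(measurable_fst.comp measurable_fst).comp (comap_measurable _),
    (measurable_snd.comp measurable_fst).comp (comap_measurable _)⟩

end History

namespace IsLambdaSAGA

variable {Ω : Type*} [mΩ : MeasurableSpace Ω] {P : Measure Ω} {d N : ℕ}
  {f : Fin N → EuclideanSpace ℝ (Fin d) → ℝ} {lam : ℝ} {γ : ℕ → ℝ} {U : ℕ → Ω → Fin N}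
  {X : ℕ → Ω → EuclideanSpace ℝ (Fin d)} {g : ℕ → Fin N → Ω → EuclideanSpace ℝ (Fin d)}

theorem sagaHistory_le (hX : IsLambdaSAGA P f lam γ U X g) (n : ℕ) : sagaHistory U X n ≤ mΩ :=
  Measurable.comap_le ((hX.measurable_init_zero.prodMk hX.measurable_init_one).prodMk
    (measurable_pi_lambda _ fun i => hX.measurable_index i))

theorem indep_sagaHistory [IsProbabilityMeasure P] (hX : IsLambdaSAGA P f lam γ U X g) (n : ℕ) :
    Indep (sagaHistory U X n) (MeasurableSpace.comap (U (n + 2)) inferInstance) P := by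
  have hAB : IndepFun (fun ω => fun i : Finset.range n => U (i + 2) ω) (U (n + 2)) P := by
    have h := hX.indep_index.indepFun_finset (Finset.range n) {n} (by simp) hX.measurable_index
    exact h.comp measurable_id
      (ψ := fun z : (({n} : Finset ℕ) → Fin N) => z ⟨n, by simp⟩) (by fun_prop)
  have hA : Measurable (fun ω => fun i : Finset.range n => U (i + 2) ω) :=
    measurable_pi_lambda _ fun i => hX.measurable_index i
  refine IndepFun.prodMk_left_of_indepFun_prodMk
    (hX.measurable_init_zero.prodMk hX.measurable_init_one) hA (hX.measurable_index n) ?_ hAB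
  exact hX.indep_init.comp measurable_id
    (ψ := fun z : ℕ → Fin N => ((fun i : Finset.range n => z i), z n)) (by fun_prop)

/-- Off by one: `X (n + 1)` and `g (n + 1)` use only the indices up to `U (n + 1)`, hence are
independent of `U (n + 2)`, which drives the next step. -/
theorem measurable_sagaHistory (hX : IsLambdaSAGA P f lam γ U X g) (n : ℕ) :
    Measurable[sagaHistory U X n] (X (n + 1)) ∧
      ∀ k, Measurable[sagaHistory U X n] (g (n + 1) k) := by
  induction n with
  | zero =>
    obtain ⟨h0, h1⟩ := measurable_init_sagaHistory U X
    refine ⟨h1, fun k => ?_⟩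
    rw [show g (0 + 1) k = gradient (f k) ∘ X 0 from funext (hX.table_init k)]
    exact (measurable_gradient (f k)).comp h0
  | succ n ih =>
    have hX' := ih.1.mono (sagaHistory_mono_succ U X n) le_rfl
    have hg' := fun k => (ih.2 k).mono (sagaHistory_mono_succ U X n) le_rfl
    have hU := measurable_index_sagaHistory U X n
    have hgrad := fun k => (measurable_gradient (f k)).comp hX'
    constructor
    · rw [show X (n + 1 + 1) = _ from funext (hX.step (n + 1) (by omega))]
      have h1 := measurable_apply_index (m := sagaHistory U X (n + 1)) hgrad hU
      have h2 := measurable_apply_index (m := sagaHistory U X (n + 1)) hg' hU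
      have h3 := Finset.measurable_fun_sum (m := sagaHistory U X (n + 1)) Finset.univ
        fun k _ => hg' k
      exact hX'.sub ((h1.sub ((h2.sub (h3.const_smul (1 / (N : ℝ)))).const_smul lam)).const_smul
        (γ (n + 1)))
    · intro k
      rw [show g (n + 1 + 1) k = _ from funext (hX.table_step (n + 1) (by omega) k)]
      exact Measurable.ite (m := sagaHistory U X (n + 1)) (hU (measurableSet_singleton k))
        (hgrad k) (hg' k)

end IsLambdaSAGA

/-! ### Moment recursions for position and table -/

theorem measurable_norm_pow {Ω E : Type*} {m : MeasurableSpace Ω} [NormedAddCommGroup E]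
    [MeasurableSpace E] [OpensMeasurableSpace E] {v : Ω → E} (hv : Measurable v) (q : ℕ) :
    Measurable fun ω => ‖v ω‖ ^ q :=
  hv.norm.pow_const q

namespace IsLambdaSAGA

variable {Ω : Type*} [mΩ : MeasurableSpace Ω] {P : Measure Ω} {d N : ℕ}
  {f : Fin N → EuclideanSpace ℝ (Fin d) → ℝ} {lam : ℝ} {γ : ℕ → ℝ} {U : ℕ → Ω → Fin N}
  {X : ℕ → Ω → EuclideanSpace ℝ (Fin d)} {g : ℕ → Fin N → Ω → EuclideanSpace ℝ (Fin d)}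

theorem integral_position_step_le [IsProbabilityMeasure P] (hX : IsLambdaSAGA P f lam γ U X g)
    (hN : 1 ≤ N) (xs : EuclideanSpace ℝ (Fin d)) (q n : ℕ) {R : Ω → ℝ} (hR : Integrable R P)
    (hbound : ∀ ω, (1 / (N : ℝ)) * ∑ k, ‖(X (n + 1) ω - xs) - γ (n + 1) •
      (gradient (f k) (X (n + 1) ω)
        - lam • (g (n + 1) k ω - (1 / (N : ℝ)) • ∑ j, g (n + 1) j ω))‖ ^ q ≤ R ω) :
    Integrable (fun ω => ‖X (n + 2) ω - xs‖ ^ q) P ∧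
      ∫ ω, ‖X (n + 2) ω - xs‖ ^ q ∂P ≤ ∫ ω, R ω ∂P := by
  have hN' : (0 : ℝ) < N := by exact_mod_cast hN
  set Φ : Fin N → Ω → ℝ := fun k ω => ‖(X (n + 1) ω - xs) - γ (n + 1) •
      (gradient (f k) (X (n + 1) ω)
        - lam • (g (n + 1) k ω - (1 / (N : ℝ)) • ∑ j, g (n + 1) j ω))‖ ^ q with hΦ
  obtain ⟨hXm, hgm⟩ := hX.measurable_sagaHistory n
  have hΦm (k) : Measurable[sagaHistory U X n] (Φ k) := by
    have hG := (measurable_gradient (f k)).comp hXm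
    have hs := Finset.measurable_fun_sum (m := sagaHistory U X n) Finset.univ fun k _ => hgm k
    exact measurable_norm_pow ((hXm.sub_const xs).sub ((hG.sub (((hgm k).sub
      (hs.const_smul (1 / (N : ℝ)))).const_smul lam)).const_smul (γ (n + 1)))) q
  have hΦi (k) : Integrable (Φ k) P := by
    -- A nonnegative term is at most `N` times the average, so `N * R` dominates.
    refine (hR.const_mul (N : ℝ)).mono'
      ((hΦm k).mono (hX.sagaHistory_le n) le_rfl).aestronglyMeasurable
      (Filter.Eventually.of_forall fun ω => ?_)
    have h0 (k) : 0 ≤ Φ k ω := by positivity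
    rw [Real.norm_of_nonneg (h0 k)]
    have h1 := hbound ω
    replace h1 : ∑ k, Φ k ω ≤ N * R ω := by
      rwa [← inv_mul_le_iff₀ hN', ← one_div]
    exact (Finset.single_le_sum (f := fun k => Φ k ω) (fun k _ => h0 k)
      (Finset.mem_univ k)).trans h1
  have heq : (fun ω => ‖X (n + 2) ω - xs‖ ^ q) = fun ω => Φ (U (n + 2) ω) ω := by
    funext ω
    rw [show X (n + 2) ω = _ from hX.step (n + 1) (by omega) ω, sub_right_comm]
  obtain ⟨h1, h2⟩ := integral_comp_uniform_of_indep (hX.measurable_index n)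
    (hX.uniform_index n) (hX.indep_sagaHistory n) hΦm hΦi
  rw [heq]
  refine ⟨h1, h2.trans_le (integral_mono ?_ hR hbound)⟩
  exact (integrable_finsetSum _ fun k _ => hΦi k).const_mul _

theorem integral_table_step_eq [IsProbabilityMeasure P] (hX : IsLambdaSAGA P f lam γ U X g)
    (hN : 1 ≤ N) (S : Fin N → EuclideanSpace ℝ (Fin d)) (q n : ℕ)
    (hG : ∀ k, Integrable (fun ω => ‖lam • (gradient (f k) (X (n + 1) ω) - S k)‖ ^ q) P)
    (hg : ∀ k, Integrable (fun ω => ‖lam • (g (n + 1) k ω - S k)‖ ^ q) P) :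
    (∀ k, Integrable (fun ω => ‖lam • (g (n + 2) k ω - S k)‖ ^ q) P) ∧
      ∫ ω, (1 / (N : ℝ)) * ∑ k, ‖lam • (g (n + 2) k ω - S k)‖ ^ q ∂P
        = (1 - 1 / (N : ℝ)) * ∫ ω, (1 / (N : ℝ)) * ∑ k, ‖lam • (g (n + 1) k ω - S k)‖ ^ q ∂P
          + (1 / (N : ℝ)) * ∫ ω, (1 / (N : ℝ)) *
            ∑ k, ‖lam • (gradient (f k) (X (n + 1) ω) - S k)‖ ^ q ∂P := by
  have hN' : (N : ℝ) ≠ 0 := by positivity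
  obtain ⟨hXm, hgm⟩ := hX.measurable_sagaHistory n
  have hGm (k) : Measurable[sagaHistory U X n]
      (fun ω => ‖lam • (gradient (f k) (X (n + 1) ω) - S k)‖ ^ q) :=
    measurable_norm_pow ((((measurable_gradient (f k)).comp hXm).sub_const (S k)).const_smul lam) q
  have hhm (k) : Measurable[sagaHistory U X n] (fun ω => ‖lam • (g (n + 1) k ω - S k)‖ ^ q) :=
    measurable_norm_pow (((hgm k).sub_const (S k)).const_smul lam) q
  have hk (k) : Integrable (fun ω => ‖lam • (g (n + 2) k ω - S k)‖ ^ q) P ∧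
      ∫ ω, ‖lam • (g (n + 2) k ω - S k)‖ ^ q ∂P
        = (1 - 1 / (N : ℝ)) * ∫ ω, ‖lam • (g (n + 1) k ω - S k)‖ ^ q ∂P
          + (1 / (N : ℝ)) * ∫ ω, ‖lam • (gradient (f k) (X (n + 1) ω) - S k)‖ ^ q ∂P := by
    set Ψ : Fin N → Ω → ℝ := fun j => if j = k
      then fun ω => ‖lam • (gradient (f k) (X (n + 1) ω) - S k)‖ ^ q
      else fun ω => ‖lam • (g (n + 1) k ω - S k)‖ ^ q with hΨ
    have heq : (fun ω => ‖lam • (g (n + 2) k ω - S k)‖ ^ q) = fun ω => Ψ (U (n + 2) ω) ω := by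
      funext ω
      rw [show g (n + 2) k ω = _ from hX.table_step (n + 1) (by omega) k ω]
      by_cases h : U (n + 2) ω = k <;> simp [hΨ, h]
    obtain ⟨h1, h2⟩ := integral_comp_uniform_of_indep (Φ := Ψ) (hX.measurable_index n)
      (hX.uniform_index n) (hX.indep_sagaHistory n)
      (fun j => by
        by_cases h : j = k
        · simpa only [hΨ, if_pos h] using hGm k
        · simpa only [hΨ, if_neg h] using hhm k)
      (fun j => by
        by_cases h : j = k
        · simpa only [hΨ, if_pos h] using hG k
        · simpa only [hΨ, if_neg h] using hg k)
    rw [heq]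
    refine ⟨h1, h2.trans ?_⟩
    have hsum (ω) : (1 / (N : ℝ)) * ∑ j, Ψ j ω
        = (1 - 1 / (N : ℝ)) * ‖lam • (g (n + 1) k ω - S k)‖ ^ q
          + (1 / (N : ℝ)) * ‖lam • (gradient (f k) (X (n + 1) ω) - S k)‖ ^ q := by
      have hj (j) : Ψ j ω = ‖lam • (g (n + 1) k ω - S k)‖ ^ q + if j = k then
          ‖lam • (gradient (f k) (X (n + 1) ω) - S k)‖ ^ q
            - ‖lam • (g (n + 1) k ω - S k)‖ ^ q else 0 := by
        by_cases h : j = k <;> simp [hΨ, h]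
      simp only [hj, Finset.sum_add_distrib, Finset.sum_const, Finset.card_univ,
        Fintype.card_fin, nsmul_eq_mul, Finset.sum_ite_eq', Finset.mem_univ, if_true]
      field_simp
      ring
    simp only [hsum]
    rw [integral_add ((hg k).const_mul _) ((hG k).const_mul _), integral_const_mul,
      integral_const_mul]
  refine ⟨fun k => (hk k).1, ?_⟩
  simp only [integral_const_mul]
  rw [integral_finsetSum _ fun k _ => (hk k).1, integral_finsetSum _ fun k _ => hg k,
    integral_finsetSum _ fun k _ => hG k]
  simp only [(hk _).2, Finset.sum_add_distrib, ← Finset.mul_sum]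
  ring

end IsLambdaSAGA

/-! ### The moment bound -/

theorem theorem4 {Ω : Type*} [MeasurableSpace Ω] (P : Measure Ω) [IsProbabilityMeasure P]
    (d N : ℕ) (hN : 1 ≤ N)
    (f : Fin N → EuclideanSpace ℝ (Fin d) → ℝ) (hf : ∀ k, Differentiable ℝ (f k))
    (lam : ℝ) (hlam : lam ∈ Set.Icc (0 : ℝ) 1)
    (c α : ℝ) (hc : 0 < c) (hα : 1 / 2 < α) (hα' : α ≤ 1)
    (U : ℕ → Ω → Fin N) (X : ℕ → Ω → EuclideanSpace ℝ (Fin d))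
    (g : ℕ → Fin N → Ω → EuclideanSpace ℝ (Fin d))
    (hX : IsLambdaSAGA P f lam (fun n => c / (n : ℝ) ^ α) U X g)
    (p : ℕ) (hp : 1 ≤ p)
    (hX1 : MemLp (X 1) (2 * p) P) (hX0 : lam ≠ 0 → MemLp (X 0) (2 * p) P)
    -- `f` is continuously differentiable with unique equilibrium point `xs`
    (xs : EuclideanSpace ℝ (Fin d))
    (hC1 : ContDiff ℝ 1 (averageObjective f))
    (hxs : gradient (averageObjective f) xs = 0)
    (huniq : ∀ x, gradient (averageObjective f) x = 0 → x = xs)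
    -- restricted secant inequality
    (μ : ℝ) (hμ : 0 < μ)
    (hsec : ∀ x, x ≠ xs →
      inner ℝ (x - xs) (gradient (averageObjective f) x) ≥ μ * ‖x - xs‖ ^ 2)
    -- Lipschitz-type condition of order `2p` at `xs`
    (L : ℝ) (hL : 0 < L)
    (hLip : ∀ x, (1 / (N : ℝ)) * ∑ k, ‖gradient (f k) x - gradient (f k) xs‖ ^ (2 * p)
      ≤ L * ‖x - xs‖ ^ (2 * p))
    (hpc : p * c * μ ≤ (2 : ℝ) ^ α) (hcμ : α = 1 → c * μ > 1) :
    ∃ K : ℝ, 0 < K ∧ ∀ n : ℕ, 1 ≤ n →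
      Integrable (fun ω => ‖X n ω - xs‖ ^ (2 * p)) P ∧
      ∫ ω, ‖X n ω - xs‖ ^ (2 * p) ∂P ≤ K / (n : ℝ) ^ ((p : ℝ) * α) := by
  obtain ⟨r, rfl⟩ : ∃ r, p = r + 1 := ⟨p - 1, by omega⟩
  have hN' : (0 : ℝ) < N := by exact_mod_cast hN
  have hq : 2 * (r + 1) = 2 * r + 2 := by ring
  rw [hq] at hLip ⊢
  set q := 2 * r + 2 with hqdef
  have hμr : 0 < (r + 1) * μ := by positivity
  set γ : ℕ → ℝ := fun n => c / (n : ℝ) ^ α with hγ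
  set S : Fin N → EuclideanSpace ℝ (Fin d) := fun k => gradient (f k) xs with hS
  set B : ℝ := (1 / (N : ℝ)) * ∑ k, ‖S k‖ ^ q with hB
  have hS0 : (1 / (N : ℝ)) • ∑ k, S k = 0 := by
    rw [← gradient_averageObjective hf, hxs]
  -- This `δ` costs a quarter of the drift `2(r+1)μ`, leaving `σ = 3/2 (r+1)μ`. The final rate `ρ =
  -- (r+1)μ` is smaller still, and for `α = 1` the condition `r + 1 < ρ * c` is `c * μ > 1`.
  obtain ⟨C, hC, hstep⟩ := average_norm_step_pow_le r (δ := (r + 1) * μ / 2) (Γ := c) μ B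
    (by positivity) hc.le hL.le (by positivity)
  have hγ0 (n : ℕ) : 0 ≤ γ n := by positivity
  have hγc (n : ℕ) : γ (n + 1) ≤ c :=
    div_le_self hc.le (Real.one_le_rpow (by push_cast; linarith [n.cast_nonneg (α := ℝ)])
      (by linarith))
  have hcomp (y : EuclideanSpace ℝ (Fin d)) (k : Fin N) :
      ‖lam • (gradient (f k) y - S k)‖ ^ q ≤ ‖gradient (f k) y - S k‖ ^ q := by
    gcongr
    rw [norm_smul, Real.norm_of_nonneg hlam.1]
    exact mul_le_of_le_one_left (norm_nonneg _) hlam.2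
  have hcompL (y : EuclideanSpace ℝ (Fin d)) (k : Fin N) :
      ‖lam • (gradient (f k) y - S k)‖ ^ q ≤ N * (L * ‖y - xs‖ ^ q) := by
    have h := hLip y
    rw [one_div, inv_mul_le_iff₀ hN'] at h
    exact (hcomp y k).trans ((Finset.single_le_sum
      (f := fun k => ‖gradient (f k) y - S k‖ ^ q) (fun _ _ => by positivity)
      (Finset.mem_univ k)).trans h)
  have hmeasX (n : ℕ) : Measurable (X (n + 1)) :=
    (hX.measurable_sagaHistory n).1.mono (hX.sagaHistory_le n) le_rfl
  have hgradint (Y : Ω → EuclideanSpace ℝ (Fin d)) (hY : Measurable Y)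
      (hYi : Integrable (fun ω => ‖Y ω - xs‖ ^ q) P) (k : Fin N) :
      Integrable (fun ω => ‖lam • (gradient (f k) (Y ω) - S k)‖ ^ q) P := by
    refine ((hYi.const_mul L).const_mul (N : ℝ)).mono' ?_
      (Filter.Eventually.of_forall fun ω => ?_)
    · exact (measurable_norm_pow ((((measurable_gradient (f k)).comp hY).sub_const
        (S k)).const_smul lam) q).aestronglyMeasurable
    · rw [Real.norm_of_nonneg (by positivity)]
      exact hcompL (Y ω) k
  have hinit (Y : Ω → EuclideanSpace ℝ (Fin d)) (hY : MemLp Y (2 * (r + 1 : ℕ)) P) :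
      Integrable (fun ω => ‖Y ω - xs‖ ^ q) P := by
    have h : MemLp (fun ω => Y ω - xs) (q : ℕ) P := by
      have h' := hY.sub (memLp_const (μ := P) xs)
      rw [← hq]
      exact_mod_cast h'
    exact h.integrable_norm_pow (by omega)
  have hmoment (n : ℕ)
      (hx : Integrable (fun ω => ‖X (n + 1) ω - xs‖ ^ q) P)
      (hg : ∀ k, Integrable (fun ω => ‖lam • (g (n + 1) k ω - S k)‖ ^ q) P) :
      Integrable (fun ω => ‖X (n + 2) ω - xs‖ ^ q) P ∧
      ∫ ω, ‖X (n + 2) ω - xs‖ ^ q ∂P ≤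
        (1 - (3 / 2 * ((r + 1) * μ)) * γ (n + 1) + C * γ (n + 1) ^ (r + 2))
          * ∫ ω, ‖X (n + 1) ω - xs‖ ^ q ∂P
        + C * γ (n + 1) ^ (r + 2)
          * (∫ ω, (1 / (N : ℝ)) * ∑ k, ‖lam • (g (n + 1) k ω - S k)‖ ^ q ∂P + 1) := by
    have hgi : Integrable (fun ω => (1 / (N : ℝ)) * ∑ k, ‖lam • (g (n + 1) k ω - S k)‖ ^ q) P :=
      (integrable_finsetSum _ fun k _ => hg k).const_mul _
    have hRg := (hgi.add (integrable_const (1 : ℝ))).const_mul (C * γ (n + 1) ^ (r + 2))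
    have hRx := hx.const_mul (1 - (3 / 2 * ((r + 1) * μ)) * γ (n + 1) + C * γ (n + 1) ^ (r + 2))
    have h := hX.integral_position_step_le hN xs q n (hRx.add hRg) fun ω => by
      refine (hstep (X (n + 1) ω - xs) (fun k => gradient (f k) (X (n + 1) ω)) S
        (fun k => g (n + 1) k ω) lam (γ (n + 1)) hN (hγ0 _) (hγc _) hlam hS0 ?_ (hLip _)
        le_rfl).trans_eq ?_
      · rw [← gradient_averageObjective hf]
        by_cases hω : X (n + 1) ω = xs
        · simp [hω]
        · exact hsec _ hω
      · simp only [Pi.add_apply]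
        ring
    refine ⟨h.1, h.2.trans_eq ?_⟩
    rw [integral_add' hRx hRg, integral_const_mul, integral_const_mul, integral_add' hgi
      (integrable_const _)]
    simp
  have hint (n : ℕ) : Integrable (fun ω => ‖X (n + 1) ω - xs‖ ^ q) P ∧
      ∀ k, Integrable (fun ω => ‖lam • (g (n + 1) k ω - S k)‖ ^ q) P := by
    induction n with
    | zero =>
      refine ⟨hinit _ hX1, fun k => ?_⟩
      simp only [zero_add, hX.table_init]
      rcases eq_or_ne lam 0 with h | h
      -- For `lam = 0` the scaled table error vanishes, so no higher moment of `X 0` is needed.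
      · simp [h, hqdef]
      · exact hgradint _ hX.measurable_init_zero (hinit _ (hX0 h)) k
    | succ n ih =>
      exact ⟨(hmoment n ih.1 ih.2).1,
        (hX.integral_table_step_eq hN S q n (hgradint _ (hmeasX n) ih.1) ih.2).1⟩
  obtain ⟨K, hK, hKn⟩ := exists_bound_of_coupled_recursion r
    (a := fun n => ∫ ω, ‖X n ω - xs‖ ^ q ∂P)
    (b := fun n => ∫ ω, (1 / (N : ℝ)) * ∑ k, ‖lam • (g n k ω - S k)‖ ^ q ∂P)
    (ρ := (r + 1) * μ) (σ := 3 / 2 * ((r + 1) * μ)) (θ := 1 / (N : ℝ)) (L := 1 / (N : ℝ) * L)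
    hc (by linarith) hα' hμr (by linarith) hC (by positivity)
    (fun h => by nlinarith [hcμ h, r.cast_nonneg (α := ℝ)])
    (fun n _ => integral_nonneg fun ω => by positivity)
    (fun n _ => integral_nonneg fun ω => by positivity)
    (fun n hn => by
      obtain ⟨m, rfl⟩ : ∃ m, n = m + 1 := ⟨n - 1, by omega⟩
      exact (hmoment m (hint m).1 (hint m).2).2)
    (fun n hn => by
      obtain ⟨m, rfl⟩ : ∃ m, n = m + 1 := ⟨n - 1, by omega⟩
      have hG := hgradint _ (hmeasX m) (hint m).1
      refine (hX.integral_table_step_eq hN S q m hG (hint m).2).2.trans_le ?_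
      rw [mul_assoc (1 / (N : ℝ)) L]
      gcongr
      rw [← integral_const_mul]
      refine integral_mono ((integrable_finsetSum _ fun k _ => hG k).const_mul _)
        ((hint m).1.const_mul L) fun ω => le_trans ?_ (hLip (X (m + 1) ω))
      exact mul_le_mul_of_nonneg_left (Finset.sum_le_sum fun k _ => hcomp _ k) (by positivity))
  refine ⟨K, hK, fun n hn => ⟨?_, hKn n hn⟩⟩
  obtain ⟨m, rfl⟩ : ∃ m, n = m + 1 := ⟨n - 1, by omega⟩
  exact (hint m).1
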